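/- Theorem. Two directed acyclic graphs (DAGs) on the same node set are Markov equivalent if they encode the same conditional independence relations, i.e. the same d-separation statements; the equivalence classes are called Markov equivalence classes (MECs). For an undirected graph $G$ let $M(G)$ be the number of MECs with skeleton (underlying undirected graph) $G$. An immorality of a DAG is an induced subgraph of the form $i\to j\leftarrow l$. If $P$ is a graph $G$ in which some edges have prescribed directions, or some edges are not allowed to be involved in any immorality, let $M(P)$ be the number of MECs that contain a DAG with skeleton $G$ that satisfies these constraints. For $k\ge 1$ let $T_k$ be the (rooted) complete binary tree with $2^k-1$ nodes, and let $A_k$ be the additive tree obtained from $T_k$ by attaching one new leaf $r$ to the root $c$ of $T_k$; this leaf $r$ is regarded as the root of $A_k$, and $c$ is its only child. For $k\geq 2$ let $p,q$ be the two children of $c$. Further: * $X_k$ is $A_k$ with the prescribed arrows $r\to c$, $p\to c$ and $c\to q$ for $k\ge 2$, so that $r\to c\leftarrow p$ is the only immorality at $c$; for $k=1$ only the arrow $r\to c$ is prescribed. * $Y_k$ is $T_k$ with the constraint that the edges at its root are not involved in any immorality. * $Z_k$ is $A_k$ with prescribed arrows from $r$ to $c$ and from $c$ to each of its children (if any). Then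 the following hold. (a) $M(T_1)=1$, and $M(T_k)=M(A_{k-1})^2+M(Y_k)$ for $k\ge2$. (b) $M(A_1)=1$, and $M(A_k)=M(T_k)+2M(X_k)+M(T_{k-1})^2$ for $k\ge2$. (c) $M(X_1)=1$, and $M(X_k)=M(T_{k-1})\sqrt{M(Z_k)}$ for $k\ge2$. (d) $M(Y_1)=1$, and $M(Y_k)=2M(Z_{k-1})M(T_{k-1})-M(Z_{k-1})^2$ for $k\ge2$. (e) $M(Z_1)=M(Z_2)=1$, and $M(Z_k)=\bigl(2M(X_{k-1})+M(T_{k-2})^2+M(Z_{k-1})\bigr)^2$ for $k\ge3$. -/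

import Mathlib

/-- A directed acyclic graph (DAG) on the node set `V`. -/
structure DAG (V : Type*) where
  /-- the underlying directed graph; `graph.Adj i j` is the arrow `i → j` -/
  graph : Digraph V
  acyclic : ∀ v, ¬ Relation.TransGen graph.Adj v v

namespace DAG

variable {V : Type*}

/-- The skeleton: the underlying undirected graph. -/
def skeleton (D : DAG V) : SimpleGraph V := D.graph.toSimpleGraphInclusive

/-- `D.Immorality i j k`: the induced subgraph on `i, j, k` is `i → j ← k`. -/
def Immorality (D : DAG V) (i j k : V) : Prop :=
  i ≠ k ∧ D.graph.Adj i j ∧ D.graph.Adj k j ∧ ¬ D.skeleton.Adj i k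

/-- A path of the skeleton is active given `C` if each of its inner nodes that is a collider
on the path has a descendant (possibly itself) in `C`, and none of its other inner nodes
is in `C`. -/
def Active (D : DAG V) (C : Set V) {a b : V} (p : D.skeleton.Walk a b) : Prop :=
  ∀ n, n + 2 ≤ p.length →
    let u := p.getVert n
    let v := p.getVert (n + 1)
    let w := p.getVert (n + 2)
    ((D.graph.Adj u v ∧ D.graph.Adj w v) → ∃ d ∈ C, Relation.ReflTransGen D.graph.Adj v d) ∧
    (¬ (D.graph.Adj u v ∧ D.graph.Adj w v) → v ∉ C)

/-- `A` and `B` are d-separated given `C`: no path from `A` to `B` is active given `C`. -/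
def DSep (D : DAG V) (A B C : Set V) : Prop :=
  ∀ a ∈ A, ∀ b ∈ B, ∀ p : D.skeleton.Walk a b, p.IsPath → ¬ D.Active C p

/-- The conditional independence relations `A ⫫ B | C` encoded by a DAG: triples of pairwise
disjoint sets of nodes with `A` and `B` d-separated given `C`. -/
def ciRelations (D : DAG V) : Set (Set V × Set V × Set V) :=
  {t | Disjoint t.1 t.2.1 ∧ Disjoint t.1 t.2.2 ∧ Disjoint t.2.1 t.2.2 ∧ D.DSep t.1 t.2.1 t.2.2}

/-- Markov equivalence: encoding the same conditional independence relations. -/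
def markovSetoid (V : Type*) : Setoid (DAG V) := Setoid.ker ciRelations

end DAG

/-- Markov equivalence classes (MECs) of DAGs on the node set `V`. -/
def MEC (V : Type*) : Type _ := Quotient (DAG.markovSetoid V)

/-- The class of a DAG. -/
def DAG.mec {V : Type*} (D : DAG V) : MEC V := Quotient.mk (DAG.markovSetoid V) D

/-- An undirected graph together with prescribed directions for some of its edges and with a set
of edges that are not allowed to take part in any immorality. -/
structure PDGraph (V : Type*) where
  skeleton : SimpleGraph V
  /-- the prescribed arrows -/
  arrow : V → V → Prop
  /-- the edges that may not be involved in any immorality -/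
  moral : Set (Sym2 V)

namespace PDGraph

variable {V : Type*}

/-- A DAG extends a partially directed graph if it has the same skeleton, contains the prescribed
arrows, and has no immorality that involves a `moral` edge. -/
def Extends (P : PDGraph V) (D : DAG V) : Prop :=
  D.skeleton = P.skeleton ∧
  (∀ i j, P.arrow i j → D.graph.Adj i j) ∧
  ∀ i j k, D.Immorality i j k → s(i, j) ∉ P.moral ∧ s(k, j) ∉ P.moral

/-- `M(P)`: the number of MECs that contain a DAG extending `P`. -/
noncomputable def M (P : PDGraph V) : ℕ :=
  Set.ncard {c : MEC V | ∃ D : DAG V, D.mec = c ∧ P.Extends D}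

/-- An undirected graph `G`, without further constraints; `M (unconstrained G)` is the number
`M(G)` of MECs with skeleton `G`. -/
def unconstrained (G : SimpleGraph V) : PDGraph V where
  skeleton := G
  arrow _ _ := False
  moral := ∅

end PDGraph

/-- The `2 ^ k - 1` nodes of the complete binary tree with `k` levels: words of length `< k` in two
letters. The root is `[]`, and the two children of `w` are `w ++ [false]` and `w ++ [true]`. -/
abbrev TreeNode (k : ℕ) : Type := {w : List Bool // w.length < k}

/-- The complete binary tree on `2 ^ k - 1` nodes. -/
def binTree (k : ℕ) : SimpleGraph (TreeNode k) :=
  SimpleGraph.fromRel fun v w => ∃ b : Bool, w.1 = v.1 ++ [b]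

/-- The nodes of the additive tree: those of the complete binary tree, and one more leaf `none`. -/
abbrev AddNode (k : ℕ) : Type := Option (TreeNode k)

/-- `IsNode x w`: the node `x` of the additive tree is the node `w` of the binary tree. -/
def IsNode {k : ℕ} (x : AddNode k) (w : List Bool) : Prop := ∃ v : TreeNode k, x = some v ∧ v.1 = w

/-- The additive tree: the leaf `none`, which serves as its root, is joined to the root `[]` of the
complete binary tree. -/
def addTree (k : ℕ) : SimpleGraph (AddNode k) :=
  SimpleGraph.fromRel fun x y =>
    (x = none ∧ IsNode y []) ∨ ∃ v w : TreeNode k, x = some v ∧ y = some w ∧ (binTree k).Adj v w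

namespace BinTree

/-- `T_k` -/
def T (k : ℕ) : PDGraph (TreeNode k) := PDGraph.unconstrained (binTree k)

/-- `A_k` -/
def A (k : ℕ) : PDGraph (AddNode k) := PDGraph.unconstrained (addTree k)

/-- `X_k`: the additive tree, with root `r`, child `c` of the root, and children `p`, `q` of `c`,
with the arrows `r → c`, `p → c`, `c → q` (as far as these nodes exist), so that `r → c ← p` is the
only immorality at `c`. -/
def X (k : ℕ) : PDGraph (AddNode k) where
  skeleton := addTree k
  arrow x y :=
    (x = none ∧ IsNode y []) ∨ (IsNode x [false] ∧ IsNode y []) ∨ (IsNode x [] ∧ IsNode y [true])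
  moral := ∅

/-- `Y_k`: the complete binary tree, where the edges at the root are in no immorality. -/
def Y (k : ℕ) : PDGraph (TreeNode k) where
  skeleton := binTree k
  arrow _ _ := False
  moral := {e | e ∈ (binTree k).edgeSet ∧ ∃ v ∈ e, v.1 = []}

/-- `Z_k`: the additive tree with arrows from the root `r` to its child `c` and from `c` to each of
its children. -/
def Z (k : ℕ) : PDGraph (AddNode k) where
  skeleton := addTree k
  arrow x y := (x = none ∧ IsNode y []) ∨ (IsNode x [] ∧ ∃ b : Bool, IsNode y [b])
  moral := ∅

end BinTree

/-! On a forest, Markov equivalence means having the same immoralities (`mec_eq_iff`), so counting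
classes amounts to counting realisable sets of immoralities. A DAG on either tree is a choice, for
each node, of the direction of the edge above it, and its immoralities form a `Pattern`: one record
per node that has children, giving the colliding pairs among its three edges. The binary tree is the
additive tree with the root edge pointing up, since such an edge is in no immorality.

Let U and W be the sets of patterns of depth k with the root edge pointing up and down respectively,
and F the set with it pointing down and in no immorality. Then F = U ∩ W (`freePatterns_eq_inter`),
and the counts for T, A, Z at index k + 1 are |U|, |U ∪ W|, |F|; the count for X at k + 2 is |U||W|.

Once the three arrows at the top node are fixed, the two branches are independent
(`image_pattern_succ`), so each set at depth k + 1 is a union of products of sets at depth k. With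
u, w, f the sizes of U, W, F, inclusion–exclusion gives 2fu - f² for Y at k + 2, and u² + 2uw + w² -
2fw for T at k + 2. The latter equals (u + w - f)² + (2fu - f²), which is (a). The sets F at depth k
+ 1 are W × W, which gives the square in (e) and the square root in (c). -/

/-! ### Markov equivalence on forests -/

namespace DAG

variable {V : Type*} {D E : DAG V}

theorem asymm (D : DAG V) {u v : V} (h : D.graph.Adj u v) : ¬ D.graph.Adj v u :=
  fun h' => D.acyclic u (.tail (.single h) h')

theorem skeleton_adj {u v : V} :
    D.skeleton.Adj u v ↔ D.graph.Adj u v ∨ D.graph.Adj v u := by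
  unfold skeleton Digraph.toSimpleGraphInclusive
  rw [SimpleGraph.fromRel_adj, and_iff_right_iff_imp]
  rintro h rfl
  exact D.acyclic u (.single (h.elim id id))

theorem not_skeleton_adj_of_common_neighbor (hD : D.skeleton.IsAcyclic) {u v w : V} (huw : u ≠ w)
    (huv : D.skeleton.Adj u v) (hvw : D.skeleton.Adj v w) : ¬ D.skeleton.Adj u w := by
  intro h
  have h1 : (SimpleGraph.Walk.cons huv (.cons hvw .nil)).IsPath := by
    simp [huv.ne, hvw.ne, huw]
  have h2 : (SimpleGraph.Walk.cons h .nil).IsPath := by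
    simp [huw]
  have := congrArg (fun p => p.1.length) ((hD.subsingleton_path u w).elim ⟨_, h1⟩ ⟨_, h2⟩)
  simp at this

theorem immorality_iff (hD : D.skeleton.IsAcyclic) {i j k : V} :
    D.Immorality i j k ↔ i ≠ k ∧ D.graph.Adj i j ∧ D.graph.Adj k j :=
  ⟨fun h => ⟨h.1, h.2.1, h.2.2.1⟩, fun h => ⟨h.1, h.2.1, h.2.2,
    not_skeleton_adj_of_common_neighbor hD h.1 (skeleton_adj.2 (.inl h.2.1))
      (skeleton_adj.2 (.inr h.2.2))⟩⟩

/-- Descendants of the centre of an immorality are determined by the immoralities. -/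
theorem descendant_of_immorality_iff (hs : E.skeleton = D.skeleton) (hD : D.skeleton.IsAcyclic)
    (h : ∀ i j k, D.Immorality i j k ↔ E.Immorality i j k) {u v w d : V}
    (hv : D.Immorality u v w) (hd : Relation.ReflTransGen D.graph.Adj v d) :
    Relation.ReflTransGen E.graph.Adj v d := by
  have hE : E.skeleton.IsAcyclic := hs ▸ hD
  -- The induction also carries an arrow x → d common to both DAGs. If the next arrow d → z were
  -- reversed in `E`, then x → d ← z would be an immorality of `E`, hence of `D`, contrary to d → z.
  suffices H : Relation.ReflTransGen E.graph.Adj v d ∧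
      ∃ x, D.graph.Adj x d ∧ E.graph.Adj x d from H.1
  induction hd with
  | refl => exact ⟨.refl, u, hv.2.1, ((h _ _ _).1 hv).2.1⟩
  | @tail y z _ hyz ih =>
    obtain ⟨hvy, x, hxD, hxE⟩ := ih
    have hyzE : E.graph.Adj y z := by
      have : E.skeleton.Adj y z := hs ▸ skeleton_adj.2 (.inl hyz)
      refine (skeleton_adj.1 this).resolve_right fun hzy => ?_
      have hxz : x ≠ z := fun e => D.asymm hyz (e ▸ hxD)
      exact D.asymm hyz ((h _ _ _).2 ((immorality_iff hE).2 ⟨hxz, hxE, hzy⟩)).2.2.1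
    exact ⟨hvy.tail hyzE, y, hyz, hyzE⟩

/-- On a path in a forest, colliders are exactly immoralities, so both DAGs have the same ones.
Whether a descendant of a collider lies in `C` carries over by `descendant_of_immorality_iff`. -/
theorem Active.mapLe (hs : E.skeleton = D.skeleton) (hD : D.skeleton.IsAcyclic)
    (h : ∀ i j k, D.Immorality i j k ↔ E.Immorality i j k) {C : Set V} {a b : V}
    {p : D.skeleton.Walk a b} (hp : p.IsPath) (hC : D.Active C p) :
    E.Active C (p.mapLe hs.ge) := by
  have hE : E.skeleton.IsAcyclic := hs ▸ hD
  intro n hn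
  simp only [SimpleGraph.Walk.length_map, SimpleGraph.Walk.mapLe] at hn
  have hne : p.getVert n ≠ p.getVert (n + 2) := fun e => by
    have := hp.getVert_injOn (by simp; omega) (by simp; omega) e
    omega
  have key : D.graph.Adj (p.getVert n) (p.getVert (n + 1)) ∧
        D.graph.Adj (p.getVert (n + 2)) (p.getVert (n + 1)) ↔
      E.graph.Adj (p.getVert n) (p.getVert (n + 1)) ∧
        E.graph.Adj (p.getVert (n + 2)) (p.getVert (n + 1)) := by
    have := h (p.getVert n) (p.getVert (n + 1)) (p.getVert (n + 2))
    rw [immorality_iff hD, immorality_iff hE] at this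
    tauto
  obtain ⟨h1, h2⟩ := hC n hn
  simp only [SimpleGraph.Walk.mapLe, SimpleGraph.Walk.getVert_map, SimpleGraph.Hom.coe_ofLE, id]
  rw [← key]
  refine ⟨fun hc => ?_, h2⟩
  obtain ⟨d, hd, hvd⟩ := h1 hc
  exact ⟨d, hd, descendant_of_immorality_iff hs hD h ((immorality_iff hD).2 ⟨hne, hc.1, hc.2⟩) hvd⟩

theorem DSep.of_immoralities (hs : E.skeleton = D.skeleton) (hD : D.skeleton.IsAcyclic)
    (h : ∀ i j k, D.Immorality i j k ↔ E.Immorality i j k) {A B C : Set V} (hsep : E.DSep A B C) :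
    D.DSep A B C := fun a ha b hb p hp hC =>
  hsep a ha b hb (p.mapLe hs.ge) ((SimpleGraph.Walk.isPath_mapLe _).2 hp) (hC.mapLe hs hD h hp)

/-- The path u, v, w is the only one between its ends, and given the empty set it is blocked exactly
when v is a collider. Thus the independence relations determine the immoralities. -/
theorem dSep_empty_iff (hD : D.skeleton.IsAcyclic) {u v w : V} (huw : u ≠ w)
    (huv : D.skeleton.Adj u v) (hvw : D.skeleton.Adj v w) :
    D.DSep {u} {w} ∅ ↔ D.Immorality u v w := by
  rw [immorality_iff hD]
  have hp : (SimpleGraph.Walk.cons huv (.cons hvw .nil)).IsPath := by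
    simp [huv.ne, hvw.ne, huw]
  constructor
  · intro h
    refine ⟨huw, ?_⟩
    by_contra hc
    refine h u rfl w rfl _ hp fun n hn => ?_
    obtain rfl : n = 0 := by simpa using hn
    exact ⟨fun h => (hc h).elim, fun _ => id⟩
  · rintro ⟨_, h1, h2⟩ _ rfl _ rfl p hp' hact
    obtain rfl : p = _ := congrArg Subtype.val ((hD.subsingleton_path _ _).elim ⟨_, hp'⟩ ⟨_, hp⟩)
    obtain ⟨d, hd, _⟩ := (hact 0 (by simp)).1 ⟨h1, h2⟩
    exact hd

/-- DAGs with the same acyclic skeleton are Markov equivalent if and only if they have the same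
immoralities. -/
theorem mec_eq_iff (hs : E.skeleton = D.skeleton) (hD : D.skeleton.IsAcyclic) :
    D.mec = E.mec ↔ ∀ i j k, D.Immorality i j k ↔ E.Immorality i j k := by
  have hE : E.skeleton.IsAcyclic := hs ▸ hD
  have hmec : D.mec = E.mec ↔ D.ciRelations = E.ciRelations := by
    exact Quotient.eq (r := markovSetoid V)
  rw [hmec]
  constructor
  · intro h i j k
    by_cases hik : i ≠ k ∧ D.skeleton.Adj i j ∧ D.skeleton.Adj j k
    · obtain ⟨hik, hij, hjk⟩ := hik
      have := Set.ext_iff.1 h ({i}, {k}, ∅)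
      rw [← dSep_empty_iff hD hik hij hjk,
        ← dSep_empty_iff hE hik (hs ▸ hij) (hs ▸ hjk)]
      simpa [ciRelations, hik] using this
    · refine iff_of_false (fun hi => hik ?_) (fun hi => hik ?_)
      · exact ⟨hi.1, skeleton_adj.2 (.inl hi.2.1), skeleton_adj.2 (.inr hi.2.2.1)⟩
      · exact ⟨hi.1, hs ▸ skeleton_adj.2 (.inl hi.2.1), hs ▸ skeleton_adj.2 (.inr hi.2.2.1)⟩
  · intro h
    ext t
    simp only [ciRelations, Set.mem_ofPred_eq]
    have : D.DSep t.1 t.2.1 t.2.2 ↔ E.DSep t.1 t.2.1 t.2.2 :=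
      ⟨DSep.of_immoralities hs.symm hE fun i j k => (h i j k).symm, DSep.of_immoralities hs hD h⟩
    rw [this]

end DAG

/-! ### A criterion for acyclicity -/

/-- A graph is acyclic if every node has at most one neighbour that is not deeper than itself. -/
theorem SimpleGraph.isAcyclic_of_depth {V : Type*} (G : SimpleGraph V) (d : V → ℕ)
    (h : ∀ u v w, G.Adj v u → G.Adj v w → d u ≤ d v → d w ≤ d v → u = w) : G.IsAcyclic := by
  classical
  intro a c hc
  -- At a deepest node `m` of a cycle, both neighbours along the cycle are no deeper, yet distinct.
  obtain ⟨m, hm, hmax⟩ := c.support.toFinset.exists_max_image d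
    ⟨a, by simp⟩
  simp only [List.mem_toFinset] at hm hmax
  have hc' := hc.rotate hm
  have hsub : ∀ x ∈ (c.rotate m hm).support, d x ≤ d m := fun x hx =>
    hmax x ((c.mem_support_rotate_iff _ hm).1 hx)
  refine hc'.snd_ne_penultimate (h _ m _ ?_ ?_ ?_ ?_)
  · exact SimpleGraph.Walk.adj_snd hc'.not_nil
  · exact (SimpleGraph.Walk.adj_penultimate hc'.not_nil).symm
  · exact hsub _ (SimpleGraph.Walk.getVert_mem_support _ _)
  · exact hsub _ (SimpleGraph.Walk.getVert_mem_support _ _)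

/-! ### Sets of patterns and their sizes -/

/-- Patterns of immoralities in the additive tree `addTree (k + 1)`: for each inner node, which pairs of edges among (parent, left child), (parent, right child) and
(left child, right child) form an immorality. -/
def Pattern : ℕ → Type
  | 0 => Unit
  | k + 1 => (Bool × Bool × Bool) × Pattern k × Pattern k

/-- An orientation of the infinite binary tree with an additional root edge: the edge above the
node `w` points downwards if and only if `f w` holds. -/
abbrev Orientation₂ : Type := List Bool → Bool

/-- The pattern with a given local pattern at the top node and given branches. -/
def Pattern.mk {k : ℕ} (l : Bool × Bool × Bool) (s t : Pattern k) : Pattern (k + 1) := (l, s, t)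

theorem Pattern.mk_inj {k : ℕ} {l l' : Bool × Bool × Bool} {s t s' t' : Pattern k} :
    mk l s t = mk l' s' t' ↔ l = l' ∧ s = s' ∧ t = t' := by
  unfold mk
  exact Prod.mk_inj.trans (and_congr_right' Prod.mk_inj)

theorem Pattern.exists_eq_mk {k : ℕ} (x : Pattern (k + 1)) : ∃ l s t, x = mk l s t :=
  ⟨x.1, x.2.1, x.2.2, rfl⟩

namespace Orientation₂

/-- The restriction of an orientation to the branch at a child of the top node. -/
def sub (f : Orientation₂) (b : Bool) : Orientation₂ := fun w => f (b :: w)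

/-- The immoralities at a node, given the arrows that point towards it. -/
def localPattern (x y z : Bool) : Bool × Bool × Bool := (x && y, x && z, y && z)

/-- The pattern of immoralities of an orientation of the additive tree
`addTree (k + 1)`. -/
def pattern : (k : ℕ) → Orientation₂ → Pattern k
  | 0, _ => ()
  | k + 1, f => .mk (localPattern (f []) (!f [false]) (!f [true]))
      (pattern k (f.sub false)) (pattern k (f.sub true))

/-- The orientation with a given arrow at the root and given branches. -/
def node (c : Bool) (g h : Orientation₂) : Orientation₂
  | [] => c
  | false :: w => g w
  | true :: w => h w

/-- The patterns of orientations in which the root edge points downwards (`true`) or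
upwards (`false`). -/
def rootPatterns (k : ℕ) (c : Bool) : Set (Pattern k) := pattern k '' {f | f [] = c}

/-- The orientations in which the root edge points downwards and is in no immorality. -/
def rootFree (k : ℕ) : Set Orientation₂ := {f | f [] = true ∧ (0 < k → ∀ b, f [b] = true)}

/-- The patterns of orientations in which the root edge points downwards and is in no
immorality. -/
def freePatterns (k : ℕ) : Set (Pattern k) := pattern k '' rootFree k

end Orientation₂

instance Pattern.finite : ∀ k, Finite (Pattern k)
  | 0 => inferInstanceAs (Finite Unit)
  | k + 1 => by
    have := Pattern.finite k
    exact inferInstanceAs (Finite ((Bool × Bool × Bool) × Pattern k × Pattern k))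

namespace Orientation₂

/-- Patterns of trees with given local pattern at the top node and given branches. -/
def join {k : ℕ} (l : Bool × Bool × Bool) (s t : Set (Pattern k)) : Set (Pattern (k + 1)) :=
  (fun x : Pattern k × Pattern k => Pattern.mk l x.1 x.2) '' s ×ˢ t

theorem mk_mem_join {k : ℕ} {l l' : Bool × Bool × Bool} {S T : Set (Pattern k)}
    {s t : Pattern k} : Pattern.mk l s t ∈ join l' S T ↔ l = l' ∧ s ∈ S ∧ t ∈ T := by
  simp only [join, Set.mem_image, Prod.exists, Set.mem_prod, Pattern.mk_inj]
  grind

theorem ncard_join {k : ℕ} (l : Bool × Bool × Bool) (s t : Set (Pattern k)) :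
    (join l s t).ncard = s.ncard * t.ncard := by
  unfold join
  rw [Set.ncard_image_of_injective _ fun x y h => Prod.ext_iff.2 (Pattern.mk_inj.1 h).2,
    Set.ncard_prod]

theorem disjoint_join {k : ℕ} {l l' : Bool × Bool × Bool} (h : l ≠ l')
    (s t s' t' : Set (Pattern k)) : Disjoint (join l s t) (join l' s' t') := by
  rw [Set.disjoint_left]
  intro x h1 h2
  obtain ⟨l, s, t, rfl⟩ := x.exists_eq_mk
  exact h ((mk_mem_join.1 h1).1.symm.trans (mk_mem_join.1 h2).1)

/-- The branches interact with the top node only through the arrows above them. With these fixed by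
`hS` and `hS'`, the local pattern is constant and any two branches can be glued by `node`. -/
theorem image_pattern_succ {k : ℕ} (c a b : Bool) {S S' : Set Orientation₂}
    (hS : ∀ f ∈ S, f [] = a) (hS' : ∀ f ∈ S', f [] = b) :
    pattern (k + 1) '' {f | f [] = c ∧ f.sub false ∈ S ∧ f.sub true ∈ S'} =
      join (localPattern c (!a) (!b)) (pattern k '' S) (pattern k '' S') := by
  ext x
  obtain ⟨l, s, t, rfl⟩ := x.exists_eq_mk
  rw [mk_mem_join]
  constructor
  · rintro ⟨f, ⟨rfl, h1, h2⟩, h⟩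
    obtain ⟨rfl, rfl, rfl⟩ := Pattern.mk_inj.1 h
    rw [← hS _ h1, ← hS' _ h2]
    exact ⟨rfl, ⟨_, h1, rfl⟩, ⟨_, h2, rfl⟩⟩
  · rintro ⟨rfl, ⟨g, hg, rfl⟩, ⟨h, hh, rfl⟩⟩
    refine ⟨node c g h, ⟨rfl, hg, hh⟩, ?_⟩
    rw [← hS g hg, ← hS' h hh]
    rfl

theorem image_root_arrows {k : ℕ} (c a b : Bool) :
    pattern (k + 1) '' {f | f [] = c ∧ f [false] = a ∧ f [true] = b} =
      join (localPattern c (!a) (!b)) (rootPatterns k a) (rootPatterns k b) :=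
  image_pattern_succ c a b (S := {f | f [] = a}) (S' := {f | f [] = b}) (fun _ => id) (fun _ => id)

theorem rootPatterns_succ (k : ℕ) (c : Bool) :
    rootPatterns (k + 1) c =
      join (localPattern c true true) (rootPatterns k false) (rootPatterns k false) ∪
      join (localPattern c true false) (rootPatterns k false) (rootPatterns k true) ∪
      join (localPattern c false true) (rootPatterns k true) (rootPatterns k false) ∪
      join (localPattern c false false) (rootPatterns k true) (rootPatterns k true) := by
  have h1 := image_root_arrows (k := k) c false false
  have h2 := image_root_arrows (k := k) c false true
  have h3 := image_root_arrows (k := k) c true false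
  have h4 := image_root_arrows (k := k) c true true
  simp only [Bool.not_true, Bool.not_false] at h1 h2 h3 h4
  rw [← h1, ← h2, ← h3, ← h4, ← Set.image_union, ← Set.image_union, ← Set.image_union]
  unfold rootPatterns
  congr 1
  ext f
  simp only [Set.mem_ofPred_eq, Set.mem_union]
  cases f [false] <;> cases f [true] <;> simp

theorem freePatterns_succ (k : ℕ) :
    freePatterns (k + 1) =
      join (false, false, false) (rootPatterns k true) (rootPatterns k true) := by
  have := image_root_arrows (k := k) true true true
  unfold freePatterns rootFree
  simpa [localPattern] using this

theorem rootPatterns_zero (c : Bool) : rootPatterns 0 c = Set.univ := by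
  ext ⟨⟩
  exact iff_of_true ⟨fun _ => c, rfl, rfl⟩ trivial

theorem freePatterns_zero : freePatterns 0 = Set.univ := by
  ext ⟨⟩
  exact iff_of_true ⟨fun _ => true, by simp [rootFree], rfl⟩ trivial

theorem ncard_univ_pattern_zero : (Set.univ : Set (Pattern 0)).ncard = 1 :=
  Set.ncard_univ Unit |>.trans Nat.card_unique

/-- An upward root edge leaves the first two flags at the top node false. A downward root edge does
so only if both child edges point down, and that pattern is also obtained with the root edge
reversed. -/
theorem freePatterns_eq_inter :
    ∀ k, freePatterns k = rootPatterns k false ∩ rootPatterns k true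
  | 0 => by simp [freePatterns_zero, rootPatterns_zero]
  | k + 1 => by
    rw [freePatterns_succ, rootPatterns_succ, rootPatterns_succ]
    ext x
    obtain ⟨l, s, t, rfl⟩ := x.exists_eq_mk
    simp only [mk_mem_join, Set.mem_inter_iff, Set.mem_union, localPattern]
    grind

/-- The patterns in which the root edge is in an immorality. -/
theorem ncard_rootPatterns_true_diff (k : ℕ) :
    (rootPatterns (k + 1) true \ rootPatterns (k + 1) false).ncard =
      2 * ((rootPatterns k false).ncard * (rootPatterns k true).ncard)
        + (rootPatterns k false).ncard ^ 2 := by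
  -- The three terms: both child edges point up, only the left one, only the right one. If neither
  -- does, the root edge can be reversed.
  have : rootPatterns (k + 1) true \ rootPatterns (k + 1) false =
      join (true, true, true) (rootPatterns k false) (rootPatterns k false) ∪
      join (true, false, false) (rootPatterns k false) (rootPatterns k true) ∪
      join (false, true, false) (rootPatterns k true) (rootPatterns k false) := by
    rw [rootPatterns_succ, rootPatterns_succ]
    ext x
    obtain ⟨l, s, t, rfl⟩ := x.exists_eq_mk
    simp only [mk_mem_join, Set.mem_sdiff, Set.mem_union, localPattern]
    grind
  have d1 := disjoint_join (show (true, true, true) ≠ (true, false, false) by decide)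
    (rootPatterns k false) (rootPatterns k false) (rootPatterns k false) (rootPatterns k true)
  have d2 := disjoint_join (show (true, true, true) ≠ (false, true, false) by decide)
    (rootPatterns k false) (rootPatterns k false) (rootPatterns k true) (rootPatterns k false)
  have d3 := disjoint_join (show (true, false, false) ≠ (false, true, false) by decide)
    (rootPatterns k false) (rootPatterns k true) (rootPatterns k true) (rootPatterns k false)
  rw [this, Set.ncard_union_eq (Set.disjoint_union_left.2 ⟨d2, d3⟩) (Set.toFinite _)
    (Set.toFinite _), Set.ncard_union_eq d1 (Set.toFinite _) (Set.toFinite _),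
    ncard_join, ncard_join, ncard_join]
  ring

theorem ncard_rootPatterns_true (k : ℕ) :
    (rootPatterns k true).ncard =
      (rootPatterns k true \ rootPatterns k false).ncard + (freePatterns k).ncard := by
  rw [freePatterns_eq_inter, Set.inter_comm]
  rw [add_comm, Set.ncard_inter_add_ncard_sdiff_eq_ncard]

theorem range_pattern (k : ℕ) :
    Set.range (pattern k) = rootPatterns k false ∪ rootPatterns k true := by
  unfold rootPatterns
  rw [← Set.image_union, ← Set.image_univ]
  congr 1
  ext f
  cases h : f [] <;> simp [h]

theorem ncard_range_pattern (k : ℕ) :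
    (Set.range (pattern k)).ncard =
      (rootPatterns k false).ncard + (rootPatterns k true \ rootPatterns k false).ncard := by
  rw [range_pattern, ← Set.union_sdiff_self,
    Set.ncard_union_eq Set.disjoint_sdiff_right (Set.toFinite _) (Set.toFinite _)]

/-- The orientations in which the root edge points upwards and the edges below the top node are in
no immorality. -/
def topFree (k : ℕ) : Set Orientation₂ :=
  {f | f [] = false ∧ ¬ (f [false] = false ∧ f [true] = false) ∧
    ∀ b, f [b] = true → f.sub b ∈ rootFree k}

/-- At most one child edge points up. Its branch is arbitrary in U, and the other branch lies in F.
If both point down, the pattern lies in F × F, which is absorbed because F ⊆ U. -/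
theorem image_topFree (k : ℕ) :
    pattern (k + 1) '' topFree k =
      join (false, false, false) (freePatterns k) (rootPatterns k false) ∪
      join (false, false, false) (rootPatterns k false) (freePatterns k) := by
  have hF : ∀ f ∈ rootFree k, f [] = true := fun f hf => hf.1
  have h1 := image_pattern_succ (k := k) false true false hF (S' := {f | f [] = false})
    (fun _ => id)
  have h2 := image_pattern_succ (k := k) false false true (S := {f | f [] = false})
    (fun _ => id) hF
  have h3 := image_pattern_succ (k := k) false true true hF hF
  have hsub : freePatterns k ⊆ rootPatterns k false := by
    rw [freePatterns_eq_inter]; exact Set.inter_subset_left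
  have : topFree k =
      {f | f [] = false ∧ f.sub false ∈ rootFree k ∧ f.sub true ∈ {f | f [] = false}} ∪
      {f | f [] = false ∧ f.sub false ∈ {f | f [] = false} ∧ f.sub true ∈ rootFree k} ∪
      {f | f [] = false ∧ f.sub false ∈ rootFree k ∧ f.sub true ∈ rootFree k} := by
    ext f
    have hf := hF (f.sub false)
    have ht := hF (f.sub true)
    simp only [topFree, Set.mem_ofPred_eq, Set.mem_union, Bool.forall_bool]
    simp only [sub] at hf ht ⊢
    clear h1 h2 h3 hsub
    cases h0 : f [false] <;> cases h1 : f [true] <;> simp [h0, h1] at hf ht ⊢ <;> tauto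
  rw [this, Set.image_union, Set.image_union, h1, h2, h3]
  refine Set.union_eq_self_of_subset_right ?_
  intro x hx
  obtain ⟨l, s, t, rfl⟩ := x.exists_eq_mk
  obtain ⟨hl, hs, ht⟩ := mk_mem_join.1 hx
  exact .inl (mk_mem_join.2 ⟨hl, hs, hsub ht⟩)

/-- Inclusion–exclusion for F × U and U × F, which meet in F × F; written additively to avoid
truncated subtraction. -/
theorem ncard_image_topFree (k : ℕ) :
    (pattern (k + 1) '' topFree k).ncard + (freePatterns k).ncard ^ 2 =
      2 * (freePatterns k).ncard * (rootPatterns k false).ncard := by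
  have hsub : freePatterns k ⊆ rootPatterns k false := by
    rw [freePatterns_eq_inter]; exact Set.inter_subset_left
  have hi : join (false, false, false) (freePatterns k) (rootPatterns k false) ∩
      join (false, false, false) (rootPatterns k false) (freePatterns k) =
      join (false, false, false) (freePatterns k) (freePatterns k) := by
    ext x
    obtain ⟨l, s, t, rfl⟩ := x.exists_eq_mk
    simp only [mk_mem_join, Set.mem_inter_iff]
    have := @hsub s
    have := @hsub t
    tauto
  have := Set.ncard_union_add_ncard_inter
    (join (false, false, false) (freePatterns k) (rootPatterns k false))
    (join (false, false, false) (rootPatterns k false) (freePatterns k))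
    (Set.toFinite _) (Set.toFinite _)
  rw [hi, ncard_join, ncard_join, ncard_join] at this
  rw [image_topFree, pow_two, this]
  ring

theorem ncard_rootPatterns_false_succ (k : ℕ) :
    (rootPatterns (k + 1) false).ncard =
      (Set.range (pattern k)).ncard ^ 2 + (pattern (k + 1) '' topFree k).ncard := by
  have hU := ncard_rootPatterns_true k
  have hA := ncard_range_pattern k
  have hY := ncard_image_topFree k
  set U := rootPatterns k false
  set W := rootPatterns k true
  -- Without a collider at the top, the branches range over U × W ∪ W × U ∪ W × W. This becomes a
  -- disjoint union by asking whether the right branch lies in W.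
  have hsplit : rootPatterns (k + 1) false =
      join (false, false, true) U U ∪
        (join (false, false, false) (U ∪ W) W ∪ join (false, false, false) W (U \ W)) := by
    rw [rootPatterns_succ]
    ext x
    obtain ⟨l, s, t, rfl⟩ := x.exists_eq_mk
    simp only [mk_mem_join, Set.mem_sdiff, Set.mem_union, localPattern]
    grind
  have d : Disjoint (join (false, false, false) (U ∪ W) W)
      (join (false, false, false) W (U \ W)) := by
    rw [Set.disjoint_left]
    intro x h1 h2
    obtain ⟨l, s, t, rfl⟩ := x.exists_eq_mk
    exact (mk_mem_join.1 h2).2.2.2 (mk_mem_join.1 h1).2.2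
  have dd : Disjoint (join (false, false, true) U U)
      (join (false, false, false) (U ∪ W) W ∪ join (false, false, false) W (U \ W)) :=
    Set.disjoint_union_right.2 ⟨disjoint_join (by decide) .., disjoint_join (by decide) ..⟩
  have hF : (U \ W).ncard + (freePatterns k).ncard = U.ncard := by
    rw [freePatterns_eq_inter]
    rw [add_comm, Set.ncard_inter_add_ncard_sdiff_eq_ncard]
  rw [hsplit, Set.ncard_union_eq dd (Set.toFinite _) (Set.toFinite _),
    Set.ncard_union_eq d (Set.toFinite _) (Set.toFinite _), ncard_join, ncard_join, ncard_join,
    ← range_pattern]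
  rw [hA, hU]
  -- With |U| replaced by |U \ W| + |F|, the goal is a polynomial identity modulo `hY`.
  rw [← hF] at hY ⊢
  nlinarith [hY]

end Orientation₂

/-! ### DAGs on the two trees as orientations -/

theorem Relation.not_transGen_self_of_height {V : Type*} {r : V → V → Prop} (h : V → ℤ)
    (hr : ∀ u v, r u v → h u < h v) (v : V) : ¬ Relation.TransGen r v v := fun H => by
  have : Relation.TransGen (· < ·) (h v) (h v) := H.lift h hr
  rw [Relation.transGen_eq_self] at this
  exact lt_irrefl _ this

theorem binTree_adj {k : ℕ} {u v : TreeNode k} :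
    (binTree k).Adj u v ↔ (∃ b, v.1 = u.1 ++ [b]) ∨ ∃ b, u.1 = v.1 ++ [b] := by
  rw [binTree, SimpleGraph.fromRel_adj, and_iff_right_iff_imp]
  rintro h rfl
  simp at h

theorem addTree_adj_none_none {k : ℕ} : ¬ (addTree k).Adj none none := SimpleGraph.irrefl _

theorem addTree_adj_none_some {k : ℕ} {v : TreeNode k} :
    (addTree k).Adj none (some v) ↔ v.1 = [] := by
  simp only [addTree, SimpleGraph.fromRel_adj, IsNode, Option.some_inj, reduceCtorEq]
  simp

theorem addTree_adj_some_none {k : ℕ} {v : TreeNode k} :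
    (addTree k).Adj (some v) none ↔ v.1 = [] := by
  rw [SimpleGraph.adj_comm, addTree_adj_none_some]

theorem addTree_adj_some_some {k : ℕ} {u v : TreeNode k} :
    (addTree k).Adj (some u) (some v) ↔ (binTree k).Adj u v := by
  simp only [addTree, SimpleGraph.fromRel_adj, Option.some_inj, reduceCtorEq, false_and, false_or,
    ne_eq, ↓existsAndEq, true_and, SimpleGraph.adj_comm _ v u, or_self, and_iff_right_iff_imp]
  exact fun h => h.ne

theorem isAcyclic_binTree (k : ℕ) : (binTree k).IsAcyclic := by
  refine SimpleGraph.isAcyclic_of_depth _ (fun v => v.1.length) fun u v w hu hw h1 h2 => ?_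
  rw [binTree_adj] at hu hw
  obtain ⟨b, hu⟩ | ⟨b, hu⟩ := hu
  · simp [hu] at h1
  obtain ⟨c, hw⟩ | ⟨c, hw⟩ := hw
  · simp [hw] at h2
  · exact Subtype.ext (List.append_inj' (hu.symm.trans hw) rfl).1

theorem isAcyclic_addTree (k : ℕ) : (addTree k).IsAcyclic := by
  refine SimpleGraph.isAcyclic_of_depth _ (fun x => x.elim 0 (fun v => v.1.length + 1)) ?_
  rintro (_ | u) (_ | v) (_ | w) hu hw h1 h2
  all_goals
    simp only [addTree_adj_none_none, addTree_adj_none_some, addTree_adj_some_none,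
      addTree_adj_some_some, Option.elim] at hu hw h1 h2
  · rfl
  · rw [binTree_adj, hu] at hw
    simp only [hu] at h2
    obtain ⟨c, hw⟩ | ⟨c, hw⟩ := hw
    · simp [hw] at h2
    · simp at hw
  · omega
  · rw [binTree_adj, hw] at hu
    simp only [hw] at h1
    obtain ⟨c, hu⟩ | ⟨c, hu⟩ := hu
    · simp [hu] at h1
    · simp at hu
  · rw [binTree_adj] at hu hw
    obtain ⟨b, hu⟩ | ⟨b, hu⟩ := hu
    · simp [hu] at h1
    obtain ⟨c, hw⟩ | ⟨c, hw⟩ := hw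
    · simp [hw] at h2
    · exact congrArg some (Subtype.ext (List.append_inj' (hu.symm.trans hw) rfl).1)

theorem DAG.ext_adj {V : Type*} {D E : DAG V} (h : ∀ u v, D.graph.Adj u v ↔ E.graph.Adj u v) :
    D = E := by
  obtain ⟨D, _⟩ := D
  obtain ⟨E, _⟩ := E
  obtain rfl : D = E := Digraph.ext (funext₂ fun u v => propext (h u v))
  rfl

namespace Orientation₂

variable {f g : Orientation₂} {k : ℕ}

/-- The arrows between nodes of the binary tree. -/
def Arrow (f : Orientation₂) (u v : List Bool) : Prop :=
  (∃ b, v = u ++ [b] ∧ f v = true) ∨ ∃ b, u = v ++ [b] ∧ f u = false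

/-- The arrows between nodes of the additive tree. -/
def AddArrow (f : Orientation₂) : AddNode k → AddNode k → Prop
  | none, none => False
  | none, some v => v.1 = [] ∧ f [] = true
  | some v, none => v.1 = [] ∧ f [] = false
  | some u, some v => f.Arrow u.1 v.1

/-- A height function that increases along arrows. -/
def height (f : Orientation₂) (w : List Bool) : ℤ :=
  ∑ i ∈ Finset.range (w.length + 1), if f (w.take i) then 1 else -1

theorem height_append (w : List Bool) (b : Bool) :
    f.height (w ++ [b]) = f.height w + if f (w ++ [b]) then 1 else -1 := by
  unfold height
  rw [List.length_append, List.length_singleton, Finset.sum_range_succ]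
  congr 1
  · refine Finset.sum_congr rfl fun i hi => ?_
    rw [List.take_append_of_le_length (by simpa [Nat.lt_succ_iff] using hi)]
  · rw [List.take_of_length_le (by simp)]

theorem Arrow.height_lt {u v : List Bool} (h : f.Arrow u v) : f.height u < f.height v := by
  obtain ⟨b, rfl, hb⟩ | ⟨b, rfl, hb⟩ := h <;> simp [height_append, hb]

theorem AddArrow.height_lt {x y : AddNode k} (h : f.AddArrow x y) :
    x.elim 0 (fun v => f.height v.1) < y.elim 0 (fun v => f.height v.1) := by
  match x, y with
  | none, none => exact h.elim
  | none, some v => simp [h.1, height, h.2]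
  | some v, none => simp [h.1, height, h.2]
  | some u, some v => exact Arrow.height_lt h

theorem arrow_or_arrow {u v : List Bool} :
    f.Arrow u v ∨ f.Arrow v u ↔ (∃ b, v = u ++ [b]) ∨ ∃ b, u = v ++ [b] := by
  unfold Arrow
  cases f u <;> cases f v <;> simp [or_comm]

/-- The DAG on the complete binary tree with a given orientation. -/
def treeDAG (k : ℕ) (f : Orientation₂) : DAG (TreeNode k) where
  graph := ⟨fun u v => f.Arrow u.1 v.1⟩
  acyclic := Relation.not_transGen_self_of_height (fun v => f.height v.1) fun _ _ => Arrow.height_lt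

/-- The DAG on the additive tree with a given orientation. -/
def addDAG (k : ℕ) (f : Orientation₂) : DAG (AddNode k) where
  graph := ⟨f.AddArrow⟩
  acyclic := Relation.not_transGen_self_of_height _ fun _ _ => AddArrow.height_lt

theorem addDAG_adj {x y : AddNode k} : (addDAG k f).graph.Adj x y ↔ f.AddArrow x y := Iff.rfl

theorem treeDAG_skeleton : (treeDAG k f).skeleton = binTree k := by
  ext u v
  rw [DAG.skeleton_adj, binTree_adj]
  exact arrow_or_arrow

theorem addDAG_skeleton : (addDAG k f).skeleton = addTree k := by
  ext x y
  rw [DAG.skeleton_adj, addDAG_adj, addDAG_adj]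
  match x, y with
  | none, none => simp [AddArrow]
  | none, some v =>
    rw [addTree_adj_none_some]
    cases h : f [] <;> simp [AddArrow, h]
  | some v, none =>
    rw [addTree_adj_some_none]
    cases h : f [] <;> simp [AddArrow, h]
  | some u, some v =>
    rw [addTree_adj_some_some, binTree_adj]
    exact arrow_or_arrow

/-- The value at a nonempty word is read off from the edge above it. The binary tree has no edge
above its root, so the value `c` there is free: it encodes the root edge of the additive tree, or is
set to `false` for the binary tree. -/
theorem exists_arrow_iff (r : TreeNode k → TreeNode k → Prop)
    (h : ∀ u v, (binTree k).Adj u v ↔ r u v ∨ r v u) (hr : ∀ u v, r u v → ¬ r v u) (c : Bool) :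
    ∃ f : Orientation₂, f [] = c ∧ ∀ u v, r u v ↔ f.Arrow u.1 v.1 := by
  classical
  let f : Orientation₂ := fun w => if w = [] then c else
    decide (∃ u v : TreeNode k, v.1 = w ∧ (∃ b, w = u.1 ++ [b]) ∧ r u v)
  have key : ∀ (u v : TreeNode k) (b : Bool), v.1 = u.1 ++ [b] → (f v.1 = true ↔ r u v) := by
    intro u v b hb
    have hne : v.1 ≠ [] := by simp [hb]
    simp only [f, hne, if_false, decide_eq_true_eq]
    constructor
    · rintro ⟨u', v', hv, ⟨b', hb'⟩, h'⟩
      obtain rfl := Subtype.ext hv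
      obtain rfl : u' = u := Subtype.ext (List.append_inj' (hb'.symm.trans hb) rfl).1
      exact h'
    · exact fun h' => ⟨u, v, rfl, ⟨b, hb⟩, h'⟩
  refine ⟨f, by simp [f], fun u v => ⟨fun huv => ?_, ?_⟩⟩
  · obtain ⟨b, hb⟩ | ⟨b, hb⟩ := binTree_adj.1 ((h u v).2 (.inl huv))
    · exact .inl ⟨b, hb, (key u v b hb).2 huv⟩
    · exact .inr ⟨b, hb, by simpa [← key v u b hb] using hr u v huv⟩
  · rintro (⟨b, hb, hf⟩ | ⟨b, hb, hf⟩)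
    · exact (key u v b hb).1 hf
    · refine ((h u v).1 (binTree_adj.2 (.inr ⟨b, hb⟩))).resolve_right ?_
      rw [← key v u b hb, hf]
      simp

theorem exists_eq_treeDAG {D : DAG (TreeNode k)} (hD : D.skeleton = binTree k) :
    ∃ f, f [] = false ∧ D = treeDAG k f := by
  obtain ⟨f, h0, hf⟩ := exists_arrow_iff D.graph.Adj
    (fun u v => by rw [← hD, DAG.skeleton_adj]) (fun u v => D.asymm) false
  exact ⟨f, h0, DAG.ext_adj hf⟩

theorem exists_eq_addDAG {D : DAG (AddNode (k + 1))} (hD : D.skeleton = addTree (k + 1)) :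
    ∃ f, D = addDAG (k + 1) f := by
  classical
  obtain ⟨f, h0, hf⟩ := exists_arrow_iff (fun u v => D.graph.Adj (some u) (some v))
    (fun u v => by rw [← addTree_adj_some_some, ← hD, DAG.skeleton_adj])
    (fun u v => D.asymm) (decide (D.graph.Adj none (some ⟨[], by simp⟩)))
  refine ⟨f, DAG.ext_adj fun x y => ?_⟩
  have hsk : ∀ v : TreeNode (k + 1),
      v.1 = [] ↔ D.graph.Adj none (some v) ∨ D.graph.Adj (some v) none := fun v => by
    rw [← addTree_adj_none_some, ← hD, DAG.skeleton_adj]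
  rw [addDAG_adj]
  match x, y with
  | none, none => exact iff_of_false (fun h => D.acyclic _ (.single h)) id
  | none, some v =>
    constructor
    · intro h
      have hv := (hsk v).2 (.inl h)
      obtain rfl : v = ⟨[], by simp⟩ := Subtype.ext hv
      exact ⟨hv, by simpa [h0] using h⟩
    · rintro ⟨hv, h⟩
      obtain rfl : v = ⟨[], by simp⟩ := Subtype.ext hv
      simpa [h0] using h
  | some v, none =>
    constructor
    · intro h
      have hv := (hsk v).2 (.inr h)
      obtain rfl : v = ⟨[], by simp⟩ := Subtype.ext hv
      exact ⟨hv, by simpa [h0] using D.asymm h⟩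
    · rintro ⟨hv, h⟩
      refine ((hsk v).1 hv).resolve_left ?_
      obtain rfl : v = ⟨[], by simp⟩ := Subtype.ext hv
      simpa [h0] using h
  | some u, some v => exact hf u v

/-! ### Patterns decide Markov equivalence -/

/-- The immoralities at the node `w`. -/
def patternAt (f : Orientation₂) (w : List Bool) : Bool × Bool × Bool :=
  localPattern (f w) (!f (w ++ [false])) (!f (w ++ [true]))

theorem localPattern_eq_iff {x y z x' y' z' : Bool} :
    localPattern x (!y) (!z) = localPattern x' (!y') (!z') ↔
      (x = true ∧ y = false ↔ x' = true ∧ y' = false) ∧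
      (x = true ∧ z = false ↔ x' = true ∧ z' = false) ∧
      (y = false ∧ z = false ↔ y' = false ∧ z' = false) := by
  revert x y z x' y' z'
  unfold localPattern
  decide

theorem pattern_eq_iff : pattern k f = pattern k g ↔
    ∀ w : List Bool, w.length < k → f.patternAt w = g.patternAt w := by
  induction k generalizing f g with
  | zero => exact iff_of_true rfl fun w hw => absurd hw (Nat.not_lt_zero _)
  | succ k ih =>
    rw [pattern, pattern, Pattern.mk_inj, ih, ih]
    constructor
    -- `sub` strips the first letter of a word whereas children append a last one; the two
    -- operations commute, so the cases reduce definitionally.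
    · rintro ⟨h0, h1, h2⟩ (_ | ⟨_ | _, w⟩) hw
      · exact h0
      · exact h1 w (by simpa using hw)
      · exact h2 w (by simpa using hw)
    · exact fun h => ⟨h [] (by simp), fun w hw => h (false :: w) (by simpa using hw),
        fun w hw => h (true :: w) (by simpa using hw)⟩

/-- The node `x` of the additive tree is the parent of `v`. -/
def IsParent (x : AddNode k) (v : TreeNode k) : Prop :=
  match x with
  | none => v.1 = []
  | some u => ∃ b, v.1 = u.1 ++ [b]

theorem exists_isParent (v : TreeNode k) : ∃ x, IsParent x v := by
  obtain ⟨w, hw⟩ := v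
  rcases List.eq_nil_or_concat' w with rfl | ⟨u, b, rfl⟩
  · exact ⟨none, rfl⟩
  · exact ⟨some ⟨u, by simp at hw; omega⟩, b, rfl⟩

theorem IsParent.unique {x y : AddNode k} {v : TreeNode k} (hx : IsParent x v)
    (hy : IsParent y v) : x = y := by
  match x, y with
  | none, none => rfl
  | none, some u => obtain ⟨b, hb⟩ := hy; simp [hb, IsParent] at hx
  | some u, none => obtain ⟨b, hb⟩ := hx; simp [hb, IsParent] at hy
  | some u, some w =>
    obtain ⟨b, hb⟩ := hx
    obtain ⟨c, hc⟩ := hy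
    exact congrArg some (Subtype.ext (List.append_inj' (hb.symm.trans hc) rfl).1)

theorem IsParent.addArrow_iff {x : AddNode k} {v : TreeNode k} (h : IsParent x v) :
    f.AddArrow x (some v) ↔ f v.1 = true := by
  match x with
  | none =>
    have h : v.1 = [] := h
    simp [AddArrow, h]
  | some u =>
    obtain ⟨b, hb⟩ := h
    simp [AddArrow, Arrow, hb]

theorem addArrow_some_iff_of_child {u v : TreeNode k} {b : Bool} (h : u.1 = v.1 ++ [b]) :
    f.AddArrow (some u) (some v) ↔ f u.1 = false := by
  simp [AddArrow, Arrow, h]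

theorem AddArrow.isParent_or_child {x : AddNode k} {v : TreeNode k} (h : f.AddArrow x (some v)) :
    IsParent x v ∨ ∃ (u : TreeNode k) (b : Bool), x = some u ∧ u.1 = v.1 ++ [b] := by
  match x with
  | none => exact .inl h.1
  | some u =>
    obtain ⟨b, hb, _⟩ | ⟨b, hb, _⟩ := h
    · exact .inl ⟨b, hb⟩
    · exact .inr ⟨u, b, rfl, hb⟩

theorem AddArrow.eq_of_none {x y : AddNode k} (hx : f.AddArrow x none) (hy : f.AddArrow y none) :
    x = y := by
  match x, y with
  | none, _ => exact hx.elim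
  | some _, none => exact hy.elim
  | some u, some v => exact congrArg some (Subtype.ext (hx.1.trans hy.1.symm))

/-- Two distinct in-neighbours of a node include a child, so the node is not a leaf at depth `k` and
its record covers the pair, whether parent and child or two children. The leaf `none` has a single
neighbour. -/
theorem collider_of_patternAt_eq
    (h : ∀ w : List Bool, w.length < k → f.patternAt w = g.patternAt w) {x y z : AddNode (k + 1)}
    (hxz : x ≠ z) (hx : f.AddArrow x y) (hz : f.AddArrow z y) :
    g.AddArrow x y ∧ g.AddArrow z y := by
  match y with
  | none => exact (hxz (hx.eq_of_none hz)).elim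
  | some v =>
    have hw : ∀ (u : TreeNode (k + 1)) (b : Bool), u.1 = v.1 ++ [b] → v.1.length < k :=
      fun u b hu => by have := u.2; simp [hu] at this; omega
    have hv := h v.1
    simp only [patternAt, localPattern_eq_iff] at hv
    obtain hx' | ⟨u, b, rfl, hu⟩ := hx.isParent_or_child
    · obtain hz' | ⟨u', c, rfl, hu'⟩ := hz.isParent_or_child
      · exact (hxz (hx'.unique hz')).elim
      · obtain ⟨h0, h1, -⟩ := hv (hw u' c hu')
        rw [hx'.addArrow_iff] at hx ⊢
        rw [addArrow_some_iff_of_child hu', hu'] at hz ⊢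
        cases c
        exacts [h0.1 ⟨hx, hz⟩, h1.1 ⟨hx, hz⟩]
    · obtain ⟨h0, h1, h2⟩ := hv (hw u b hu)
      rw [addArrow_some_iff_of_child hu, hu] at hx ⊢
      obtain hz' | ⟨u', c, rfl, hu'⟩ := hz.isParent_or_child
      · rw [hz'.addArrow_iff] at hz ⊢
        cases b
        exacts [(h0.1 ⟨hz, hx⟩).symm, (h1.1 ⟨hz, hx⟩).symm]
      · have hbc : b ≠ c := by
          rintro rfl
          exact hxz (congrArg some (Subtype.ext (hu.trans hu'.symm)))
        rw [addArrow_some_iff_of_child hu', hu'] at hz ⊢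
        cases b <;> cases c
        exacts [(hbc rfl).elim, h2.1 ⟨hx, hz⟩, (h2.1 ⟨hz, hx⟩).symm, (hbc rfl).elim]

theorem addDAG_immorality_iff {x y z : AddNode k} : (addDAG k f).Immorality x y z ↔
    x ≠ z ∧ f.AddArrow x y ∧ f.AddArrow z y :=
  DAG.immorality_iff (addDAG_skeleton ▸ isAcyclic_addTree k)

theorem treeDAG_immorality_iff {x y z : TreeNode k} : (treeDAG k f).Immorality x y z ↔
    x ≠ z ∧ f.Arrow x.1 y.1 ∧ f.Arrow z.1 y.1 :=
  DAG.immorality_iff (treeDAG_skeleton ▸ isAcyclic_binTree k)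

theorem mec_addDAG_eq_iff :
    (addDAG (k + 1) f).mec = (addDAG (k + 1) g).mec ↔ pattern k f = pattern k g := by
  rw [DAG.mec_eq_iff (addDAG_skeleton.trans addDAG_skeleton.symm)
    (addDAG_skeleton ▸ isAcyclic_addTree _), pattern_eq_iff]
  simp only [addDAG_immorality_iff]
  constructor
  · intro h w hw
    let v : TreeNode (k + 1) := ⟨w, by omega⟩
    let u : Bool → TreeNode (k + 1) := fun b => ⟨w ++ [b], by simp; omega⟩
    have hu : ∀ b, (u b).1 = v.1 ++ [b] := fun _ => rfl
    obtain ⟨x, hx⟩ := exists_isParent v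
    have hxu : ∀ b, x ≠ some (u b) := by
      rintro b rfl
      obtain ⟨c, hc⟩ := hx
      simp [v, u] at hc
    have huu : some (u false) ≠ some (u true) := by simp [u]
    have h0 := h x (some v) (some (u false))
    have h1 := h x (some v) (some (u true))
    have h2 := h (some (u false)) (some v) (some (u true))
    simp only [hx.addArrow_iff, addArrow_some_iff_of_child (hu _), hxu, huu, ne_eq,
      not_false_eq_true, true_and] at h0 h1 h2
    exact localPattern_eq_iff.2 ⟨h0, h1, h2⟩
  · exact fun h x y z => ⟨fun ⟨hxz, hx, hz⟩ => ⟨hxz, collider_of_patternAt_eq h hxz hx hz⟩,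
      fun ⟨hxz, hx, hz⟩ =>
        ⟨hxz, collider_of_patternAt_eq (fun w hw => (h w hw).symm) hxz hx hz⟩⟩

theorem AddArrow.exists_some (hf : f [] = false) {x z : AddNode k} {v : AddNode k} (hxz : x ≠ z)
    (hx : f.AddArrow x v) (hz : f.AddArrow z v) :
    ∃ a b c, x = some a ∧ v = some b ∧ z = some c := by
  match x, v, z with
  | _, none, _ => exact (hxz (hx.eq_of_none hz)).elim
  | none, some _, _ => simp [hf, AddArrow] at hx
  | some _, some _, none => simp [hf, AddArrow] at hz
  | some a, some b, some c => exact ⟨a, b, c, rfl, rfl, rfl⟩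

/-- A root edge pointing up ends in the leaf `none` and creates no immorality, so the binary tree
and the additive tree have the same immoralities. -/
theorem mec_treeDAG_eq_iff (hf : f [] = false) (hg : g [] = false) :
    (treeDAG (k + 1) f).mec = (treeDAG (k + 1) g).mec ↔ pattern k f = pattern k g := by
  rw [← mec_addDAG_eq_iff, DAG.mec_eq_iff (addDAG_skeleton.trans addDAG_skeleton.symm)
    (addDAG_skeleton ▸ isAcyclic_addTree _),
    DAG.mec_eq_iff (treeDAG_skeleton.trans treeDAG_skeleton.symm)
    (treeDAG_skeleton ▸ isAcyclic_binTree _)]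
  simp only [addDAG_immorality_iff, treeDAG_immorality_iff]
  constructor
  · intro h x y z
    constructor
    · rintro ⟨hxz, hx, hz⟩
      obtain ⟨a, b, c, rfl, rfl, rfl⟩ := hx.exists_some hf hxz hz
      exact ⟨hxz, ((h a b c).1 ⟨fun e => hxz (congrArg some e), hx, hz⟩).2⟩
    · rintro ⟨hxz, hx, hz⟩
      obtain ⟨a, b, c, rfl, rfl, rfl⟩ := hx.exists_some hg hxz hz
      exact ⟨hxz, ((h a b c).2 ⟨fun e => hxz (congrArg some e), hx, hz⟩).2⟩
  · intro h x y z
    have := h (some x) (some y) (some z)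
    rwa [Ne, Option.some_inj] at this

end Orientation₂

/-! ### Counting classes by counting patterns -/

/-- Two maps with the same fibres have images of the same cardinality. -/
theorem Set.ncard_image_eq_of_fibres {α β γ : Type*} {g : α → β} {h : α → γ} {s : Set α}
    (H : ∀ x ∈ s, ∀ y ∈ s, g x = g y ↔ h x = h y) : (g '' s).ncard = (h '' s).ncard := by
  refine Set.ncard_congr (fun _ hb => h hb.choose) ?_ ?_ ?_
  · exact fun b hb => ⟨_, hb.choose_spec.1, rfl⟩
  · intro b b' hb hb' e
    rw [← hb.choose_spec.2, ← hb'.choose_spec.2]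
    exact (H _ hb.choose_spec.1 _ hb'.choose_spec.1).2 e
  · rintro _ ⟨a, ha, rfl⟩
    have hb : g a ∈ g '' s := ⟨a, ha, rfl⟩
    exact ⟨g a, hb, (H _ hb.choose_spec.1 _ ha).1 hb.choose_spec.2⟩

open Orientation₂

/-- The parametrisation `dag` need not be injective: classes and patterns are both images of `S`,
with the same fibres. -/
theorem PDGraph.M_eq_ncard_image_pattern {V : Type*} {P : PDGraph V} {k : ℕ}
    {S : Set Orientation₂} (dag : Orientation₂ → DAG V)
    (hdag : ∀ D, P.Extends D ↔ ∃ f ∈ S, D = dag f)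
    (hmec : ∀ f ∈ S, ∀ g ∈ S, (dag f).mec = (dag g).mec ↔ pattern k f = pattern k g) :
    P.M = (pattern k '' S).ncard := by
  rw [← Set.ncard_image_eq_of_fibres hmec, PDGraph.M]
  congr 1
  ext c
  constructor
  · rintro ⟨D, rfl, hD⟩
    obtain ⟨f, hf, rfl⟩ := (hdag D).1 hD
    exact ⟨f, hf, rfl⟩
  · rintro ⟨f, hf, rfl⟩
    exact ⟨_, rfl, (hdag _).2 ⟨f, hf, rfl⟩⟩

theorem PDGraph.M_of_addTree {k : ℕ} {P : PDGraph (AddNode (k + 1))}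
    {S : Set Orientation₂} (hP : P.skeleton = addTree (k + 1)) (hm : P.moral = ∅)
    (hS : ∀ f : Orientation₂, (∀ x y, P.arrow x y → f.AddArrow x y) ↔ f ∈ S) :
    P.M = (pattern k '' S).ncard := by
  refine P.M_eq_ncard_image_pattern (addDAG (k + 1)) (fun D => ?_)
    fun f _ g _ => mec_addDAG_eq_iff
  constructor
  · rintro ⟨hD, ha, -⟩
    obtain ⟨f, rfl⟩ := exists_eq_addDAG (hD.trans hP)
    exact ⟨f, (hS f).1 ha, rfl⟩
  · rintro ⟨f, hf, rfl⟩
    exact ⟨addDAG_skeleton.trans hP.symm, (hS f).2 hf, by simp [hm]⟩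

theorem PDGraph.M_of_binTree {k : ℕ} {P : PDGraph (TreeNode (k + 1))}
    {S : Set Orientation₂} (hP : P.skeleton = binTree (k + 1)) (ha : ∀ x y, ¬ P.arrow x y)
    (hS : ∀ f : Orientation₂, f ∈ S ↔ f [] = false ∧
      ∀ x y z : TreeNode (k + 1), x ≠ z → f.Arrow x.1 y.1 → f.Arrow z.1 y.1 →
        s(x, y) ∉ P.moral) :
    P.M = (pattern k '' S).ncard := by
  refine P.M_eq_ncard_image_pattern (treeDAG (k + 1)) (fun D => ?_)
    fun f hf g hg => mec_treeDAG_eq_iff ((hS f).1 hf).1 ((hS g).1 hg).1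
  constructor
  · rintro ⟨hD, -, hm⟩
    obtain ⟨f, hf, rfl⟩ := exists_eq_treeDAG (hD.trans hP)
    exact ⟨f, (hS f).2 ⟨hf, fun x y z hxz hx hz =>
      (hm x y z (treeDAG_immorality_iff.2 ⟨hxz, hx, hz⟩)).1⟩, rfl⟩
  · rintro ⟨f, hf, rfl⟩
    refine ⟨treeDAG_skeleton.trans hP.symm, fun x y h => (ha x y h).elim, fun x y z h => ?_⟩
    obtain ⟨hxz, hx, hz⟩ := treeDAG_immorality_iff.1 h
    exact ⟨((hS f).1 hf).2 x y z hxz hx hz, ((hS f).1 hf).2 z y x hxz.symm hz hx⟩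

/-! ### The constrained trees as sets of patterns -/

namespace BinTree

theorem M_T (k : ℕ) : (T (k + 1)).M = (rootPatterns k false).ncard :=
  PDGraph.M_of_binTree rfl (fun _ _ => id) fun f => by
    simp [T, PDGraph.unconstrained]

theorem M_A (k : ℕ) : (A (k + 1)).M = (Set.range (pattern k)).ncard := by
  rw [← Set.image_univ]
  exact PDGraph.M_of_addTree rfl rfl fun f => by simp [A, PDGraph.unconstrained]

/-- The root of the binary tree. -/
def topNode (k : ℕ) : TreeNode (k + 1) := ⟨[], by simp⟩

/-- The children of the root of the binary tree. -/
def childNode (k : ℕ) (b : Bool) : TreeNode (k + 2) := ⟨[b], by simp⟩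

theorem isNode_nil_iff {k : ℕ} {x : AddNode (k + 1)} : IsNode x [] ↔ x = some (topNode k) :=
  ⟨fun ⟨_, h, hv⟩ => h.trans (congrArg some (Subtype.ext hv)), fun h => ⟨_, h, rfl⟩⟩

theorem isNode_singleton_iff {k : ℕ} {x : AddNode (k + 2)} {b : Bool} :
    IsNode x [b] ↔ x = some (childNode k b) :=
  ⟨fun ⟨_, h, hv⟩ => h.trans (congrArg some (Subtype.ext hv)), fun h => ⟨_, h, rfl⟩⟩

theorem not_isNode_singleton {x : AddNode 1} {b : Bool} : ¬ IsNode x [b] := by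
  rintro ⟨⟨v, hv⟩, -, rfl⟩
  simp at hv

theorem addArrow_none_topNode {k : ℕ} {f : Orientation₂} :
    f.AddArrow none (some (topNode k)) ↔ f [] = true := by
  simp [AddArrow, topNode]

theorem addArrow_topNode_childNode {k : ℕ} {f : Orientation₂} {b : Bool} :
    f.AddArrow (some (topNode (k + 1))) (some (childNode k b)) ↔ f [b] = true := by
  simp [AddArrow, Arrow, topNode, childNode]

theorem addArrow_childNode_topNode {k : ℕ} {f : Orientation₂} {b : Bool} :
    f.AddArrow (some (childNode k b)) (some (topNode (k + 1))) ↔ f [b] = false := by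
  simp [AddArrow, Arrow, topNode, childNode]

theorem M_X_one : (X 1).M = 1 := by
  refine Eq.trans (b := (rootPatterns 0 true).ncard) ?_
    (by rw [rootPatterns_zero, ncard_univ_pattern_zero])
  refine PDGraph.M_of_addTree (k := 0) rfl rfl fun f => ?_
  simp only [X, not_isNode_singleton, false_and, and_false, or_false]
  rw [Set.mem_ofPred_eq, ← addArrow_none_topNode (f := f) (k := 0)]
  simp [isNode_nil_iff]

theorem M_X (k : ℕ) :
    (X (k + 2)).M = (rootPatterns k false).ncard * (rootPatterns k true).ncard := by
  rw [← ncard_join, ← image_root_arrows true false true]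
  refine PDGraph.M_of_addTree rfl rfl fun f => ?_
  simp only [X, isNode_nil_iff, isNode_singleton_iff, Set.mem_ofPred_eq]
  rw [← addArrow_none_topNode (f := f) (k := k + 1), ← addArrow_childNode_topNode (f := f) (k := k),
    ← addArrow_topNode_childNode (f := f) (k := k)]
  grind

theorem M_Z (k : ℕ) : (Z (k + 1)).M = (freePatterns k).ncard := by
  refine PDGraph.M_of_addTree rfl rfl fun f => ?_
  simp only [Z, rootFree, Set.mem_ofPred_eq]
  rw [← addArrow_none_topNode (f := f) (k := k)]
  cases k with
  | zero =>
    simp only [not_isNode_singleton, exists_false, and_false, or_false]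
    simp [isNode_nil_iff]
  | succ k =>
    simp only [isNode_singleton_iff, isNode_nil_iff, Nat.succ_pos, forall_const,
      ← addArrow_topNode_childNode (f := f) (k := k)]
    grind

theorem M_Y_one : (Y 1).M = 1 := by
  refine Eq.trans (b := (rootPatterns 0 false).ncard) ?_
    (by rw [rootPatterns_zero, ncard_univ_pattern_zero])
  refine PDGraph.M_of_binTree (k := 0) rfl (fun _ _ => id) fun f => ?_
  rw [Set.mem_ofPred_eq, iff_self_and]
  rintro - ⟨x, hx⟩ ⟨z, hz⟩ ⟨w, hw⟩ h
  simp at hx hw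
  simp [hx, hw] at h

theorem mem_Y_moral {k : ℕ} {f : Orientation₂} {x y : TreeNode k} (h : f.Arrow x.1 y.1) :
    s(x, y) ∈ (Y k).moral ↔ x.1 = [] ∨ y.1 = [] := by
  have hxy : (binTree k).Adj x y := binTree_adj.2 (arrow_or_arrow.1 (.inl h))
  simp only [Y, Set.mem_ofPred_eq, SimpleGraph.mem_edgeSet, hxy, true_and, Sym2.mem_iff,
    exists_eq_or_imp, exists_eq_left]

/-- An immorality with an edge at the top node sits either at the top, between two children, or at a
child, between the top and a grandchild. These are the two exclusions in `topFree`. -/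
theorem M_Y (k : ℕ) : (Y (k + 2)).M = (pattern (k + 1) '' topFree k).ncard := by
  refine PDGraph.M_of_binTree rfl (fun _ _ => id) fun f => ?_
  rw [topFree, Set.mem_ofPred_eq, and_congr_right_iff]
  intro _
  have hdown : ∀ b, f [b] = true → f.Arrow [] [b] := fun b h => .inl ⟨b, rfl, h⟩
  have hup : ∀ b, f [b] = false → f.Arrow [b] [] := fun b h => .inr ⟨b, rfl, h⟩
  constructor
  · rintro ⟨h1, h2⟩ x y z hxz hx hz
    rw [mem_Y_moral hx]
    rintro (hx0 | hy0)
    · rw [hx0] at hx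
      obtain ⟨b, hb, hf⟩ | ⟨b, hb, -⟩ := hx
      · obtain ⟨c, hc, -⟩ | ⟨c, hc, hfc⟩ := hz
        · rw [hb] at hc
          exact hxz (Subtype.ext (hx0.trans (List.append_inj' hc rfl).1))
        -- Here `z` is a grandchild of the top, so there are at least three levels; this supplies
        -- the condition `0 < k` in `rootFree`.
        · have hlen := z.2
          simp only [hc, hb, List.length_append, List.length_singleton, List.length_nil] at hlen
          rw [hb] at hf
          have := (h2 b hf).2 (by omega) c
          rw [hc, hb] at hfc
          exact absurd (this.symm.trans hfc) (by simp)
      · simp at hb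
    · rw [hy0] at hx hz
      obtain ⟨b, hb, -⟩ | ⟨b, hb, hf⟩ := hx
      · simp at hb
      obtain ⟨c, hc, -⟩ | ⟨c, hc, hg⟩ := hz
      · simp at hc
      rw [hb] at hf
      rw [hc] at hg
      have hbc : b ≠ c := by
        rintro rfl
        exact hxz (Subtype.ext (hb.trans hc.symm))
      refine h1 ?_
      cases b <;> cases c <;> simp_all
  · intro h
    refine ⟨fun ⟨h0, h1⟩ => ?_, fun b hb => ⟨hb, fun hk c => ?_⟩⟩
    · exact h (childNode k false) (topNode _) (childNode k true) (by simp [childNode])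
        (hup _ h0) (hup _ h1) ((mem_Y_moral (hup _ h0)).2 (.inr rfl))
    · by_contra hc
      have hc' : f.Arrow [b, c] [b] := .inr ⟨c, rfl, by simpa [sub] using hc⟩
      exact h (topNode _) (childNode k b) ⟨[b, c], by simp; omega⟩ (by simp [topNode])
        (hdown b hb) hc' ((mem_Y_moral (hdown b hb)).2 (.inl rfl))

end BinTree

/-! ### The recursions -/

theorem mainTheorem9 :
    -- (a)
    ((BinTree.T 1).M = 1 ∧
      ∀ k : ℕ, 2 ≤ k → (BinTree.T k).M = (BinTree.A (k - 1)).M ^ 2 + (BinTree.Y k).M) ∧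
    -- (b)
    ((BinTree.A 1).M = 1 ∧
      ∀ k : ℕ, 2 ≤ k → (BinTree.A k).M =
        (BinTree.T k).M + 2 * (BinTree.X k).M + (BinTree.T (k - 1)).M ^ 2) ∧
    -- (c)
    ((BinTree.X 1).M = 1 ∧
      ∀ k : ℕ, 2 ≤ k → ((BinTree.X k).M : ℝ) =
        ((BinTree.T (k - 1)).M : ℝ) * Real.sqrt ((BinTree.Z k).M : ℝ)) ∧
    -- (d)
    ((BinTree.Y 1).M = 1 ∧
      ∀ k : ℕ, 2 ≤ k → ((BinTree.Y k).M : ℤ) =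
        2 * ((BinTree.Z (k - 1)).M : ℤ) * ((BinTree.T (k - 1)).M : ℤ)
          - ((BinTree.Z (k - 1)).M : ℤ) ^ 2) ∧
    -- (e)
    ((BinTree.Z 1).M = 1 ∧ (BinTree.Z 2).M = 1 ∧
      ∀ k : ℕ, 3 ≤ k → (BinTree.Z k).M =
        (2 * (BinTree.X (k - 1)).M + (BinTree.T (k - 2)).M ^ 2 + (BinTree.Z (k - 1)).M) ^ 2) := by
  refine ⟨⟨?_, ?_⟩, ⟨?_, ?_⟩, ⟨BinTree.M_X_one, ?_⟩, ⟨BinTree.M_Y_one, ?_⟩, ?_, ?_, ?_⟩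
  · rw [BinTree.M_T, rootPatterns_zero, ncard_univ_pattern_zero]
  · intro k hk
    obtain ⟨k, rfl⟩ := Nat.exists_eq_add_of_le' hk
    rw [BinTree.M_T, BinTree.M_Y, show k + 2 - 1 = k + 1 from rfl, BinTree.M_A,
      ncard_rootPatterns_false_succ]
  · rw [BinTree.M_A, range_pattern, rootPatterns_zero, Set.univ_union, ncard_univ_pattern_zero]
  · intro k hk
    obtain ⟨k, rfl⟩ := Nat.exists_eq_add_of_le' hk
    rw [BinTree.M_T, BinTree.M_X, show k + 2 - 1 = k + 1 from rfl, BinTree.M_A, BinTree.M_T,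
      ncard_range_pattern, ncard_rootPatterns_true_diff, add_assoc]
  · intro k hk
    obtain ⟨k, rfl⟩ := Nat.exists_eq_add_of_le' hk
    rw [BinTree.M_X, BinTree.M_Z, show k + 2 - 1 = k + 1 from rfl, BinTree.M_T,
      freePatterns_succ, ncard_join, Nat.cast_mul, Nat.cast_mul,
      Real.sqrt_mul_self (Nat.cast_nonneg _)]
  · intro k hk
    obtain ⟨k, rfl⟩ := Nat.exists_eq_add_of_le' hk
    rw [BinTree.M_Y, show k + 2 - 1 = k + 1 from rfl, BinTree.M_Z, BinTree.M_T]
    exact eq_sub_of_add_eq (mod_cast ncard_image_topFree k)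
  · rw [BinTree.M_Z, freePatterns_zero, ncard_univ_pattern_zero]
  · rw [BinTree.M_Z, freePatterns_succ, ncard_join, rootPatterns_zero, ncard_univ_pattern_zero]
  · intro k hk
    obtain ⟨k, rfl⟩ := Nat.exists_eq_add_of_le' hk
    rw [BinTree.M_Z, show k + 3 - 1 = k + 2 from rfl, show k + 3 - 2 = k + 1 from rfl,
      BinTree.M_X, BinTree.M_T, BinTree.M_Z, freePatterns_succ (k + 1), ncard_join,
      ncard_rootPatterns_true, ncard_rootPatterns_true_diff, pow_two (_ + _)]
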